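/- All graphs are finite, simple and have at least one vertex. A finite hypergraph $H$ is a finite set of finite sets (its edges), with vertex set $V(H)=\bigcup_{e\in H}e$. A cover of $H$ is a set $K\subseteq V(H)$ meeting every edge of $H$; $\tau(H)$ is the smallest size of a cover, and $C_k(H)$ is the set of covers of size exactly $k$. A fractional matching of $H$ is a function $f:H\to\mathbb{R}_{\ge 0}$ with $\sum_{e\in H:\,v\in e}f(e)\le 1$ for every $v\in V(H)$; it is perfect if equality holds for every $v\in V(H)$. Let $\nu^*(H)$ be the maximum of $\sum_{e\in H}f(e)$ over all fractional matchings $f$ of $H$. For integers $r,s\ge 1$, an $(r,s)$-loom is a pair $(A,B)$ of hypergraphs such that $|a\cap b|=1$ for all $a\in A$, $b\in B$; every edge of $A$ has size $r$ and every edge of $B$ has size $s$; $\tau(A)=s$ and $\tau(B)=r$; and $A=C_r(B)$, $B=C_s(A)$. For a graph $G$, let $PM(G)$ be the hypergraph whose edges are the perfect matchings of $G$, regarded as sets of edges of $G$. Theorem. Let $s\ge 0$ be an integer and let $G$ be an $s$-regular graph. (1) If $\tau(PM(G))\ge s-1$, then $\nu^*(PM(G))=s$. (2) For every $r$, if $\bigl(PM(G),\,C_s(PM(G))\bigr)$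 is an $(r,s)$-loom, then both $PM(G)$ and $C_s(PM(G))$ have perfect fractional matchings. -/

import Mathlib

namespace Looms

section Hypergraph

variable {α : Type*} [DecidableEq α]

/-- The vertex set `V(H) = ⋃ H` of a finite hypergraph `H`, given as its set of edges. -/
def verts (H : Finset (Finset α)) : Finset α := H.biUnion id

/-- `H` is `r`-uniform: every edge has exactly `r` vertices. -/
def IsUniform (r : ℕ) (H : Finset (Finset α)) : Prop := ∀ e ∈ H, e.card = r

/-- `A ⊥ B`: every edge of `A` meets every edge of `B` in exactly one vertex. -/
def Orthogonal (A B : Finset (Finset α)) : Prop := ∀ a ∈ A, ∀ b ∈ B, (a ∩ b).card = 1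

/-- The covers of `H`: the sets of vertices of `H` that meet every edge of `H`. -/
def covers (H : Finset (Finset α)) : Finset (Finset α) :=
  (verts H).powerset.filter fun K => ∀ e ∈ H, (K ∩ e).Nonempty

/-- `C_k(H)`: the covers of `H` with exactly `k` vertices. -/
def coversOfCard (k : ℕ) (H : Finset (Finset α)) : Finset (Finset α) :=
  (covers H).filter fun K => K.card = k

/-- The covering number `τ(H)`, the smallest size of a cover of `H`
(it is `⊤` if there is no cover, that is, if the empty set is an edge). -/
noncomputable def coveringNumber (H : Finset (Finset α)) : ℕ∞ :=
  ⨅ K ∈ covers H, (K.card : ℕ∞)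

/-- `(A, B)` is an `(r, s)`-loom. -/
structure IsLoom (r s : ℕ) (A B : Finset (Finset α)) : Prop where
  one_le_left : 1 ≤ r
  one_le_right : 1 ≤ s
  orthogonal : Orthogonal A B
  uniform_left : IsUniform r A
  uniform_right : IsUniform s B
  coveringNumber_left : coveringNumber A = s
  coveringNumber_right : coveringNumber B = r
  left_eq : A = coversOfCard r B
  right_eq : B = coversOfCard s A

/-- `f` is a fractional matching of `H`; only the values of `f` on the edges of `H` matter. -/
def IsFracMatching (H : Finset (Finset α)) (f : Finset α → ℝ) : Prop :=
  (∀ e ∈ H, 0 ≤ f e) ∧ ∀ v ∈ verts H, ∑ e ∈ H with v ∈ e, f e ≤ 1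

/-- `f` is a perfect fractional matching of `H`. -/
def IsPerfectFracMatching (H : Finset (Finset α)) (f : Finset α → ℝ) : Prop :=
  IsFracMatching H f ∧ ∀ v ∈ verts H, ∑ e ∈ H with v ∈ e, f e = 1

/-- `H` has a perfect fractional matching. -/
def HasPerfectFracMatching (H : Finset (Finset α)) : Prop :=
  ∃ f : Finset α → ℝ, IsPerfectFracMatching H f

/-- `ν*(H) = c`: the maximum of the total weight `∑ e ∈ H, f e` over all fractional matchings `f`
of `H` exists and equals `c`. -/
def FracMatchingNumberEq (H : Finset (Finset α)) (c : ℝ) : Prop :=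
  IsGreatest {x : ℝ | ∃ f : Finset α → ℝ, IsFracMatching H f ∧ x = ∑ e ∈ H, f e} c

end Hypergraph

open Classical in
/-- `PM(G)`: the hypergraph whose vertices are edges of `G` and whose edges are the edge sets of
the perfect matchings of `G`. -/
noncomputable def PM {V : Type*} [Fintype V] (G : SimpleGraph V) : Finset (Finset (Sym2 V)) :=
  G.edgeFinset.powerset.filter fun F =>
    ∃ M : G.Subgraph, M.IsPerfectMatching ∧ M.edgeSet = (F : Set (Sym2 V))

end Looms

/-!
Both parts come down to writing the all-one vector on the edges of `G` as a nonnegative combination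
of perfect matchings (`exists_fractional_edge_colouring`), that is, to showing that the constant
weighting `1 / s` lies in the perfect matching polytope.

If `T` is an odd set of vertices, every perfect matching has an edge in the cut `δ(T)`, so the cut
contains a cover of `PM(G)`. Hence `s - 1 ≤ τ(PM(G)) ≤ |δ(T)|`, and since `|δ(T)|` has the
parity of `s` for an `s`-regular graph, in fact `s ≤ |δ(T)|` (`le_card_cutPairs`). So the constant
weighting has degree `1` at every vertex and weight at least `1` on every odd cut, and Edmonds'
theorem (`IsFeasible.isMixture`) applies. The resulting fractional matching is perfect and has
total weight `s`, which is the maximum because the edges at a vertex form a cover of size `s`. In a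
loom, moreover, all vertex stars belong to `C_s(PM(G))`, and each edge lies in exactly two of
them, counted with multiplicity, so weight `1 / 2` on every star is a perfect fractional matching.

Edmonds' theorem is proved by induction on the number of vertices, for weightings of complete
graphs, which makes contraction harmless: parallel edges are merged by adding their weights. If some
odd cut `δ(T)` with both sides nontrivial is tight, contract each of its sides in turn, decompose
the two smaller weightings, and glue matchings that use compatible edges of the cut
(`IsMixture.glue`). If not, the support of the weighting has a perfect matching by Tutte's theorem
(`IsFeasible.exists_matchingMap`); subtract as much of it as possible, until either the support
shrinks or a nontrivial odd cut becomes tight (`IsFeasible.isMixture_of_tight`).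
-/

namespace MatchingPolytope

open Finset

set_option linter.unusedSectionVars false

variable {V W : Type*} [Fintype V] [DecidableEq V] [Fintype W] [DecidableEq W]

/-- The total weight of the cut `δ(T)`. -/
def cutWeight (x : V → V → ℝ) (T : Finset V) : ℝ := ∑ u ∈ T, ∑ v ∈ Tᶜ, x u v

/-- The inequalities of Edmonds' description of the perfect matching polytope of the complete graph
on `V`. An edge weighting is encoded as a symmetric matrix with zero diagonal. Taking `T = univ` in
the odd cut inequalities forces `V` to have an even number of elements. -/
structure IsFeasible (x : V → V → ℝ) : Prop where
  nonneg : ∀ u v, 0 ≤ x u v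
  symm : ∀ u v, x u v = x v u
  diag : ∀ u, x u u = 0
  deg : ∀ u, ∑ v, x u v = 1
  cut : ∀ T : Finset V, Odd #T → 1 ≤ cutWeight x T

/-- A perfect matching of the complete graph on `V`, encoded as the fixed-point-free involution
sending each vertex to its partner. -/
structure IsMatchingMap {V : Type*} (σ : V → V) : Prop where
  invol : ∀ v, σ (σ v) = v
  ne : ∀ v, σ v ≠ v

/-- `x` is a nonnegative combination of perfect matchings. When the rows of `x` sum to `1` and `V`
is nonempty, the coefficients sum to `1`, so this is membership in the convex hull. -/
def IsMixture {V : Type*} [DecidableEq V] (x : V → V → ℝ) : Prop :=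
  ∃ (ι : Type) (_ : Fintype ι) (w : ι → ℝ) (σ : ι → V → V), (∀ i, 0 ≤ w i) ∧
    (∀ i, IsMatchingMap (σ i)) ∧ ∀ u v, ∑ i, (if σ i u = v then w i else 0) = x u v

/-! ### Cut weights -/

lemma cutWeight_compl {x : V → V → ℝ} (hx : ∀ u v, x u v = x v u) (T : Finset V) :
    cutWeight x Tᶜ = cutWeight x T := by
  unfold cutWeight
  rw [compl_compl, sum_comm]
  exact sum_congr rfl fun u _ => sum_congr rfl fun v _ => hx v u

lemma cutWeight_singleton {x : V → V → ℝ} (hx : ∀ u, x u u = 0) (u : V) :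
    cutWeight x {u} = ∑ v, x u v := by
  unfold cutWeight
  rw [sum_singleton, ← sum_add_sum_compl {u} (x u), sum_singleton, hx, zero_add]

lemma IsFeasible.even_card {x : V → V → ℝ} (hx : IsFeasible x) : Even (Fintype.card V) := by
  by_contra h
  have := hx.cut univ (by simpa using h)
  simp [cutWeight] at this
  linarith

lemma IsFeasible.odd_compl {x : V → V → ℝ} (hx : IsFeasible x) {T : Finset V} (hT : Odd #T) :
    Odd #Tᶜ := by
  have h := hx.even_card
  rw [← card_add_card_compl T] at h
  rw [Nat.even_add'] at h
  exact h.1 hT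

/-! ### Contraction -/

/-- The weighting obtained by identifying the vertices in each fibre of `p` and adding up the
weights of the parallel edges that arise. -/
def pushWeight (p : V → W) (x : V → V → ℝ) (a b : W) : ℝ :=
  if a = b then 0 else ∑ u with p u = a, ∑ v with p v = b, x u v

lemma sum_fibers (p : V → W) (T : Finset W) (F : V → ℝ) :
    ∑ a ∈ T, ∑ u with p u = a, F u = ∑ u with p u ∈ T, F u := by
  simp only [sum_filter]
  rw [sum_comm]
  exact sum_congr rfl fun u _ => by simp

lemma cutWeight_pushWeight (p : V → W) (x : V → V → ℝ) (T : Finset W) :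
    cutWeight (pushWeight p x) T = cutWeight x {u | p u ∈ T} := by
  have h1 : cutWeight (pushWeight p x) T
      = ∑ a ∈ T, ∑ b ∈ Tᶜ, ∑ u with p u = a, ∑ v with p v = b, x u v := by
    refine sum_congr rfl fun a ha => sum_congr rfl fun b hb => ?_
    rw [pushWeight, if_neg]
    rintro rfl
    exact (mem_compl.1 hb) ha
  have h2 : ({u | p u ∈ T} : Finset V)ᶜ = ({u | p u ∈ Tᶜ} : Finset V) := by ext; simp
  rw [h1, cutWeight, h2, ← sum_fibers]
  refine sum_congr rfl fun a _ => ?_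
  rw [sum_comm]
  exact sum_congr rfl fun u _ => sum_fibers p Tᶜ _

/-- Feasibility survives the contraction of disjoint tight odd sets. -/
lemma IsFeasible.push {x : V → V → ℝ} (hx : IsFeasible x) (p : V → W)
    (hodd : ∀ a, Odd #{u | p u = a}) (htight : ∀ a, cutWeight x {u | p u = a} = 1) :
    IsFeasible (pushWeight p x) where
  nonneg a b := by
    unfold pushWeight
    split_ifs
    · rfl
    · exact sum_nonneg fun u _ => sum_nonneg fun v _ => hx.nonneg u v
  symm a b := by
    unfold pushWeight
    simp only [eq_comm (a := b) (b := a)]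
    rw [sum_comm]
    simp only [hx.symm]
  diag a := by simp [pushWeight]
  deg a := by
    rw [← cutWeight_singleton (fun a => by simp [pushWeight]), cutWeight_pushWeight, ← htight a]
    simp
  cut T hT := by
    rw [cutWeight_pushWeight]
    apply hx.cut
    have h : #{u | p u ∈ T} = ∑ a ∈ T, #{u | p u = a} := by
      rw [card_eq_sum_card_fiberwise (f := p) (t := T) (fun u hu => by simpa using hu)]
      refine sum_congr rfl fun a ha => congrArg card ?_
      ext u
      simp only [mem_filter, mem_univ, true_and]
      exact ⟨fun h => h.2, fun h => ⟨h ▸ ha, h⟩⟩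
    rw [h, Finset.odd_sum_iff_odd_card_odd]
    simpa [hodd] using hT

/-- The map contracting `Tᶜ` to the single vertex `none`. -/
def contract (T : Finset V) (v : V) : Option T := if h : v ∈ T then some ⟨v, h⟩ else none

lemma fiber_some (T : Finset V) (a : T) : ({u | contract T u = some a} : Finset V) = {a.1} := by
  ext u
  rw [mem_filter, mem_singleton, contract]
  split_ifs with h
  · simp [Subtype.ext_iff]
  · simp only [and_false, false_iff]
    rintro rfl
    exact h a.2

lemma fiber_none (T : Finset V) : ({u | contract T u = none} : Finset V) = Tᶜ := by
  ext u
  simp [contract]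

lemma pushWeight_contract_some {x : V → V → ℝ} (hx : ∀ u, x u u = 0) (T : Finset V) (a b : T) :
    pushWeight (contract T) x (some a) (some b) = x a b := by
  unfold pushWeight
  split_ifs with h
  · rw [Option.some.inj h, hx]
  · simp [fiber_some]

lemma pushWeight_contract_none (x : V → V → ℝ) (T : Finset V) (a : T) :
    pushWeight (contract T) x (some a) none = ∑ v ∈ Tᶜ, x a v := by
  simp [pushWeight, fiber_some, fiber_none]

lemma IsFeasible.contract {x : V → V → ℝ} (hx : IsFeasible x) {T : Finset V} (hT : Odd #T)
    (h1 : cutWeight x T = 1) : IsFeasible (pushWeight (contract T) x) := by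
  apply hx.push
  · rintro (_ | a)
    · rw [fiber_none]; exact hx.odd_compl hT
    · rw [fiber_some]; simp
  · rintro (_ | a)
    · rw [fiber_none, cutWeight_compl hx.symm, h1]
    · rw [fiber_some, cutWeight_singleton hx.diag, hx.deg]

/-! ### Gluing along a tight cut -/

/-- Two perfect matchings of the two contractions along `T` whose edges at the contracted vertices
are `none - a` and `none - b` give a perfect matching of `V` containing the edge `a - b`. -/
lemma exists_glue (T : Finset V) {σ₁ : Option T → Option T} {σ₂ : Option ↥Tᶜ → Option ↥Tᶜ}
    (h₁ : IsMatchingMap σ₁) (h₂ : IsMatchingMap σ₂) :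
    ∃ τ : V → V, IsMatchingMap τ ∧ (∀ a b : T, τ a = b ↔ σ₁ (some a) = some b) ∧
      (∀ a b : ↥Tᶜ, τ a = b ↔ σ₂ (some a) = some b) ∧
      ∀ (a : T) (b : ↥Tᶜ), τ a = b ↔ σ₁ none = some a ∧ σ₂ none = some b := by
  obtain ⟨u, hu⟩ := Option.ne_none_iff_exists'.1 (h₁.ne none)
  obtain ⟨v, hv⟩ := Option.ne_none_iff_exists'.1 (h₂.ne none)
  have hu' : σ₁ (some u) = none := by rw [← hu, h₁.invol]
  have hv' : σ₂ (some v) = none := by rw [← hv, h₂.invol]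
  have eu : ∀ a, σ₁ (some a) = none ↔ a = u := fun a =>
    ⟨fun h => by have := h₁.invol (some a); rw [h, hu] at this; exact (Option.some.inj this).symm,
      fun h => h ▸ hu'⟩
  have ev : ∀ a, σ₂ (some a) = none ↔ a = v := fun a =>
    ⟨fun h => by have := h₂.invol (some a); rw [h, hv] at this; exact (Option.some.inj this).symm,
      fun h => h ▸ hv'⟩
  let τ : V → V := fun w => if h : w ∈ T then (σ₁ (some ⟨w, h⟩)).elim v.1 (fun z => z.1)
    else (σ₂ (some ⟨w, mem_compl.2 h⟩)).elim u.1 (fun z => z.1)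
  have t1 : ∀ a : T, τ a = (σ₁ (some a)).elim v.1 (fun z => z.1) := fun a => by simp [τ]
  have t2 : ∀ a : ↥Tᶜ, τ a = (σ₂ (some a)).elim u.1 (fun z => z.1) := fun a => by
    simp [τ, mem_compl.1 a.2]
  have hne : ∀ (a : T) (b : ↥Tᶜ), a.1 ≠ b.1 := fun a b h => mem_compl.1 b.2 (h ▸ a.2)
  refine ⟨τ, ⟨fun w => ?_, fun w => ?_⟩, fun a b => ?_, fun a b => ?_, fun a b => ?_⟩
  · by_cases h : w ∈ T
    · obtain ⟨a, rfl⟩ : ∃ a : T, a.1 = w := ⟨⟨w, h⟩, rfl⟩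
      rw [t1]
      rcases hs : σ₁ (some a) with _ | b
      · rw [Option.elim_none, t2, hv', (eu a).1 hs]; rfl
      · rw [Option.elim_some, t1, ← hs, h₁.invol]; rfl
    · obtain ⟨a, rfl⟩ : ∃ a : ↥Tᶜ, a.1 = w := ⟨⟨w, mem_compl.2 h⟩, rfl⟩
      rw [t2]
      rcases hs : σ₂ (some a) with _ | b
      · rw [Option.elim_none, t1, hu', (ev a).1 hs]; rfl
      · rw [Option.elim_some, t2, ← hs, h₂.invol]; rfl
  · by_cases h : w ∈ T
    · obtain ⟨a, rfl⟩ : ∃ a : T, a.1 = w := ⟨⟨w, h⟩, rfl⟩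
      rw [t1]
      rcases hs : σ₁ (some a) with _ | b
      · exact (hne a v).symm
      · intro h'
        exact h₁.ne (some a) (by rw [hs, Subtype.ext h'])
    · obtain ⟨a, rfl⟩ : ∃ a : ↥Tᶜ, a.1 = w := ⟨⟨w, mem_compl.2 h⟩, rfl⟩
      rw [t2]
      rcases hs : σ₂ (some a) with _ | b
      · exact hne u a
      · intro h'
        exact h₂.ne (some a) (by rw [hs, Subtype.ext h'])
  · rw [t1]
    rcases hs : σ₁ (some a) with _ | c
    · simpa using (hne b v).symm
    · rw [Option.elim_some, Option.some.injEq, Subtype.ext_iff]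
  · rw [t2]
    rcases hs : σ₂ (some a) with _ | c
    · simpa using (hne u b)
    · rw [Option.elim_some, Option.some.injEq, Subtype.ext_iff]
  · rw [t1, hu, hv]
    rcases hs : σ₁ (some a) with _ | c
    · rw [(eu a).1 hs, Option.elim_none, Option.some.injEq, Option.some.injEq, Subtype.ext_iff,
        Subtype.ext_iff]
      exact ⟨fun h => ⟨rfl, h⟩, fun h => h.2⟩
    · simp only [Option.elim_some, Option.some.injEq]
      refine ⟨fun h => absurd h (hne c b), fun h => ?_⟩
      rw [h.1.symm, hu'] at hs
      cases hs

lemma IsMatchingMap.eq_comm_iff {V : Type*} {σ : V → V} (h : IsMatchingMap σ) (u v : V) :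
    σ u = v ↔ σ v = u :=
  ⟨fun e => by rw [← e, h.invol], fun e => by rw [← e, h.invol]⟩

/-- The weight of the matching glued from the `i`-th and `j`-th matchings is
`w₁ i * w₂ j * x u v / (y₁ u * y₂ v)`, where `u` and `v` are the partners of the contracted
vertices. Summing over `j` gives back `w₁ i`, and summing over `i` gives back `w₂ j`. -/
lemma sum_glue_weight {A B ι κ : Type*} [Fintype A] [Fintype B] [Fintype ι] [Fintype κ]
    [DecidableEq A] [DecidableEq B] (x : A → B → ℝ) (hx : ∀ a b, 0 ≤ x a b)
    (w₁ : ι → ℝ) (hw₁ : ∀ i, 0 ≤ w₁ i) (w₂ : κ → ℝ) (α : ι → A) (β : κ → B)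
    (h₁ : ∀ a, ∑ i, (if α i = a then w₁ i else 0) = ∑ b, x a b)
    (h₂ : ∀ b, ∑ j, (if β j = b then w₂ j else 0) = ∑ a, x a b) (i : ι) :
    ∑ j, w₁ i * w₂ j * x (α i) (β j) / ((∑ b, x (α i) b) * ∑ a, x a (β j)) = w₁ i := by
  have key : ∑ j, w₂ j * (x (α i) (β j) / ∑ a, x a (β j)) = ∑ b, x (α i) b := by
    calc ∑ j, w₂ j * (x (α i) (β j) / ∑ a, x a (β j))
        = ∑ j, ∑ b, (if β j = b then w₂ j else 0) * (x (α i) b / ∑ a, x a b) := by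
          refine sum_congr rfl fun j _ => ?_
          simp [ite_mul]
      _ = ∑ b, (∑ a, x a b) * (x (α i) b / ∑ a, x a b) := by
          rw [sum_comm]
          exact sum_congr rfl fun b _ => by rw [← sum_mul, h₂]
      _ = ∑ b, x (α i) b := by
          refine sum_congr rfl fun b _ => ?_
          rcases eq_or_ne (∑ a, x a b) 0 with h0 | h0
          · have := (sum_eq_zero_iff_of_nonneg (fun a _ => hx a b)).1 h0 (α i) (mem_univ _)
            rw [this, h0]; simp
          · field_simp
  have : ∀ j, w₁ i * w₂ j * x (α i) (β j) / ((∑ b, x (α i) b) * ∑ a, x a (β j))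
      = w₁ i / (∑ b, x (α i) b) * (w₂ j * (x (α i) (β j) / ∑ a, x a (β j))) := fun j => by
    rw [mul_assoc, mul_div_mul_comm, mul_div_assoc]
  simp_rw [this]
  rw [← mul_sum, key]
  rcases eq_or_ne (∑ b, x (α i) b) 0 with h0 | h0
  · have h := h₁ (α i)
    rw [h0, sum_eq_zero_iff_of_nonneg (fun k _ => by split_ifs; exacts [hw₁ k, le_rfl])] at h
    have := h i (mem_univ _)
    simp at this
    simp [this]
  · field_simp

/-- If both contractions along `T` decompose into perfect matchings, so does `x`: each compatible
pair of matchings is glued, with the weight of `sum_glue_weight`. -/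
lemma IsMixture.glue {x : V → V → ℝ} (hx : IsFeasible x) (T : Finset V)
    (h₁ : IsMixture (pushWeight (contract T) x)) (h₂ : IsMixture (pushWeight (contract Tᶜ) x)) :
    IsMixture x := by
  obtain ⟨ι, _, w₁, σ₁, hw₁, hσ₁, m₁⟩ := h₁
  obtain ⟨κ, _, w₂, σ₂, hw₂, hσ₂, m₂⟩ := h₂
  choose τ hτ t₁ t₂ t₁₂ using fun i j => exists_glue T (hσ₁ i) (hσ₂ j)
  choose α hα using fun i => Option.ne_none_iff_exists'.1 ((hσ₁ i).ne none)
  choose β hβ using fun j => Option.ne_none_iff_exists'.1 ((hσ₂ j).ne none)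
  let X : T → ↥Tᶜ → ℝ := fun a b => x a b
  have hX : ∀ a b, 0 ≤ X a b := fun a b => hx.nonneg _ _
  have s₁ : ∀ a, ∑ i, (if α i = a then w₁ i else 0) = ∑ b, X a b := fun a => by
    have h := m₁ (some a) none
    rw [pushWeight_contract_none, ← sum_coe_sort Tᶜ] at h
    rw [← h]
    refine sum_congr rfl fun i _ => if_congr ?_ rfl rfl
    rw [(hσ₁ i).eq_comm_iff, hα, Option.some.injEq]
  have s₂ : ∀ b, ∑ j, (if β j = b then w₂ j else 0) = ∑ a, X a b := fun b => by
    have h := m₂ (some b) none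
    rw [pushWeight_contract_none, compl_compl, ← sum_coe_sort T] at h
    simp only [X, hx.symm _ b.1]
    rw [← h]
    refine sum_congr rfl fun i _ => if_congr ?_ rfl rfl
    rw [(hσ₂ i).eq_comm_iff, hβ, Option.some.injEq]
  let w : ι × κ → ℝ := fun p =>
    w₁ p.1 * w₂ p.2 * X (α p.1) (β p.2) / ((∑ b, X (α p.1) b) * ∑ a, X a (β p.2))
  have sw₁ : ∀ i, ∑ j, w (i, j) = w₁ i := fun i => sum_glue_weight X hX w₁ hw₁ w₂ α β s₁ s₂ i
  have sw₂ : ∀ j, ∑ i, w (i, j) = w₂ j := fun j => by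
    rw [← sum_glue_weight (fun b a => X a b) (fun b a => hX a b) w₂ hw₂ w₁ β α s₂ s₁ j]
    refine sum_congr rfl fun i _ => ?_
    simp only [w]
    rw [mul_comm (w₁ i), mul_comm (∑ b, X (α i) b)]
  have cross : ∀ (a : T) (b : ↥Tᶜ), ∑ p : ι × κ, (if τ p.1 p.2 a = b then w p else 0) = x a b := by
    intro a b
    have e : ∀ p : ι × κ, (if τ p.1 p.2 a = b then w p else 0) =
        (if α p.1 = a then w₁ p.1 else 0) * (if β p.2 = b then w₂ p.2 else 0) *
          (X a b / ((∑ b, X a b) * ∑ a, X a b)) := fun p => by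
      have : τ p.1 p.2 a = b ↔ α p.1 = a ∧ β p.2 = b := by
        rw [t₁₂, hα, hβ, Option.some.injEq, Option.some.injEq]
      simp only [this]
      by_cases ha : α p.1 = a
      · by_cases hb : β p.2 = b
        · simp only [ha, hb, w, and_self, if_true]
          rw [mul_div_assoc]
        · simp [hb]
      · simp [ha]
    simp only [e]
    rw [← sum_mul, Fintype.sum_prod_type]
    simp only [← mul_sum]
    rw [← sum_mul, s₁, s₂]
    change _ = X a b
    rcases eq_or_ne (∑ b, X a b) 0 with h0 | h0
    · rw [(sum_eq_zero_iff_of_nonneg (fun b _ => hX a b)).1 h0 b (mem_univ _)]; simp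
    rcases eq_or_ne (∑ a, X a b) 0 with h0' | h0'
    · rw [(sum_eq_zero_iff_of_nonneg (fun a _ => hX a b)).1 h0' a (mem_univ _)]; simp
    · field_simp
  refine ⟨ι × κ, inferInstance, w, fun p => τ p.1 p.2, fun p => ?_, fun p => hτ _ _, ?_⟩
  · exact div_nonneg (mul_nonneg (mul_nonneg (hw₁ _) (hw₂ _)) (hX _ _))
      (mul_nonneg (sum_nonneg fun _ _ => hX _ _) (sum_nonneg fun _ _ => hX _ _))
  intro u v
  by_cases hu : u ∈ T <;> by_cases hv : v ∈ T
  · lift u to T using hu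
    lift v to T using hv
    simp only [t₁]
    rw [← pushWeight_contract_some hx.diag T u v, ← m₁, Fintype.sum_prod_type]
    refine sum_congr rfl fun i _ => ?_
    split_ifs
    · exact sw₁ i
    · simp
  · lift u to T using hu
    exact cross u ⟨v, mem_compl.2 hv⟩
  · rw [hx.symm]
    simp only [(hτ _ _).eq_comm_iff u v]
    lift v to T using hv
    exact cross v ⟨u, mem_compl.2 hu⟩
  · rw [← mem_compl] at hu hv
    lift u to ↥Tᶜ using hu
    lift v to ↥Tᶜ using hv
    simp only [t₂]
    rw [← pushWeight_contract_some hx.diag Tᶜ u v, ← m₂, Fintype.sum_prod_type, sum_comm]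
    refine sum_congr rfl fun i _ => ?_
    split_ifs
    · exact sw₂ i
    · simp

/-! ### A perfect matching in the support -/

open Classical in
/-- Each odd component left after deleting `S` sends weight at least `1` into `S`, while `S` has
total degree `#S`; so the support satisfies Tutte's condition. -/
lemma IsFeasible.exists_matchingMap {x : V → V → ℝ} (hx : IsFeasible x) :
    ∃ σ : V → V, IsMatchingMap σ ∧ ∀ v, 0 < x v (σ v) := by
  let H : SimpleGraph V :=
    { Adj := fun u v => 0 < x u v
      symm := ⟨fun u v h => by rw [hx.symm]; exact h⟩
      loopless := ⟨fun u h => by rw [hx.diag] at h; exact lt_irrefl _ h⟩ }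
  obtain ⟨M, hM⟩ : ∃ M : H.Subgraph, M.IsPerfectMatching := by
    rw [SimpleGraph.tutte]
    intro S hS
    unfold SimpleGraph.IsTutteViolator at hS
    set K := ((⊤ : H.Subgraph).deleteVerts S).coe with hK
    let comp : K.ConnectedComponent → Finset V := fun c => {v | v ∈ Subtype.val '' c.supp}
    have hcomp : ∀ c v, v ∈ comp c ↔ ∃ h : v ∈ ((⊤ : H.Subgraph).deleteVerts S).verts,
        K.connectedComponentMk ⟨v, h⟩ = c := by
      intro c v
      simp only [comp, mem_filter, mem_univ, true_and, Set.mem_image, Subtype.exists,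
        exists_and_right, exists_eq_right, SimpleGraph.ConnectedComponent.mem_supp_iff]
    have hdisj : ∀ c c', c ≠ c' → Disjoint (comp c) (comp c') := by
      intro c c' hne
      rw [Finset.disjoint_left]
      intro v h1 h2
      rw [hcomp] at h1 h2
      obtain ⟨h, rfl⟩ := h1
      exact hne h2.2
    have hcut : ∀ c : K.ConnectedComponent, Odd c.supp.ncard →
        1 ≤ ∑ u ∈ comp c, ∑ v ∈ S.toFinset, x u v := by
      intro c hc
      have hcard : #(comp c) = c.supp.ncard := by
        rw [← Set.ncard_image_of_injective _ Subtype.val_injective, ← Set.ncard_coe_finset]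
        congr 1
        ext v
        simp [comp]
      refine (hx.cut (comp c) (hcard ▸ hc)).trans (sum_le_sum fun u hu => ?_)
      -- an edge of the support leaving a component of `K` can only end in `S`
      have hz : ∀ v ∈ (comp c)ᶜ, v ∉ S.toFinset → x u v = 0 := by
        intro v hv hvS
        by_contra h0
        have hpos : 0 < x u v := lt_of_le_of_ne (hx.nonneg u v) (Ne.symm h0)
        obtain ⟨hu', hc'⟩ := (hcomp c u).1 hu
        have hv' : v ∈ ((⊤ : H.Subgraph).deleteVerts S).verts := by
          simpa using hvS
        refine mem_compl.1 hv ((hcomp c v).2 ⟨hv', ?_⟩)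
        rw [← hc', SimpleGraph.ConnectedComponent.eq]
        apply SimpleGraph.Adj.reachable
        simp only [hK, SimpleGraph.Subgraph.coe_adj, SimpleGraph.Subgraph.deleteVerts_adj]
        simp only [SimpleGraph.Subgraph.deleteVerts_verts, Set.mem_sdiff] at hu' hv'
        refine ⟨hv'.1, hv'.2, hu'.1, hu'.2, ?_⟩
        change 0 < x v u
        rwa [hx.symm]
      calc ∑ v ∈ (comp c)ᶜ, x u v = ∑ v ∈ (comp c)ᶜ with v ∈ S.toFinset, x u v := by
            rw [sum_filter]
            exact sum_congr rfl fun v hv => by split_ifs with h; exacts [rfl, hz v hv h]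
        _ ≤ ∑ v ∈ S.toFinset, x u v :=
            sum_le_sum_of_subset_of_nonneg (fun v hv => (mem_filter.1 hv).2)
              fun v _ _ => hx.nonneg u v
    have hle : (K.oddComponents.ncard : ℝ) ≤ S.ncard := by
      rw [Set.ncard_eq_toFinset_card' K.oddComponents, Set.ncard_eq_toFinset_card' S]
      calc ((#K.oddComponents.toFinset : ℕ) : ℝ) = ∑ c ∈ K.oddComponents.toFinset, (1 : ℝ) := by simp
        _ ≤ ∑ c ∈ K.oddComponents.toFinset, ∑ u ∈ comp c, ∑ v ∈ S.toFinset, x u v :=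
            sum_le_sum fun c hc => hcut c (by simpa using hc)
        _ = ∑ u ∈ K.oddComponents.toFinset.biUnion comp, ∑ v ∈ S.toFinset, x u v :=
            (sum_biUnion fun c _ c' _ h => hdisj c c' h).symm
        _ ≤ ∑ u, ∑ v ∈ S.toFinset, x u v :=
            sum_le_sum_of_subset_of_nonneg (subset_univ _)
              fun u _ _ => sum_nonneg fun v _ => hx.nonneg u v
        _ = ∑ v ∈ S.toFinset, ∑ u, x v u := by
            rw [sum_comm]
            exact sum_congr rfl fun v _ => sum_congr rfl fun u _ => hx.symm u v
        _ = #S.toFinset := by simp [hx.deg]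
    exact absurd hS (not_lt.2 (by exact_mod_cast hle))
  rw [SimpleGraph.Subgraph.isPerfectMatching_iff] at hM
  choose σ hσ hu using hM
  exact ⟨σ, ⟨fun v => (hu _ v (M.adj_symm (hσ v))).symm, fun v => (M.adj_sub (hσ v)).ne'⟩, fun v => M.adj_sub (hσ v)⟩

/-! ### Subtracting a perfect matching -/

/-- The first time at which one of finitely many affine functions `a i - ε * b i` vanishes. -/
lemma exists_first_zero {ι : Type*} (s : Finset ι) (a b : ι → ℝ) (ha : ∀ i ∈ s, 0 ≤ a i) {δ : ℝ}
    (hδ : 0 ≤ δ) (h : ∃ i ∈ s, a i - δ * b i < 0) :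
    ∃ ε, 0 ≤ ε ∧ ε < δ ∧ (∀ i ∈ s, 0 ≤ a i - ε * b i) ∧ ∃ i ∈ s, 0 < b i ∧ a i - ε * b i = 0 := by
  obtain ⟨k, hk, hneg⟩ := h
  have hbk : 0 < b k := by
    by_contra hb
    nlinarith [ha k hk, mul_nonneg hδ (neg_nonneg.2 (not_lt.1 hb))]
  obtain ⟨i, hi, hmin⟩ := exists_min_image {i ∈ s | 0 < b i} (fun i => a i / b i)
    ⟨k, mem_filter.2 ⟨hk, hbk⟩⟩
  obtain ⟨his, hbi⟩ := mem_filter.1 hi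
  refine ⟨a i / b i, div_nonneg (ha i his) hbi.le, ?_, fun j hj => ?_, i, his, hbi, ?_⟩
  · refine (hmin k (mem_filter.2 ⟨hk, hbk⟩)).trans_lt ?_
    rw [div_lt_iff₀ hbk]
    linarith
  · rcases lt_or_ge 0 (b j) with hbj | hbj
    · have := hmin j (mem_filter.2 ⟨hj, hbj⟩)
      rw [le_div_iff₀ hbj] at this
      linarith
    · have := mul_nonneg (div_nonneg (ha i his) hbi.le) (neg_nonneg.2 hbj)
      linarith [ha j hj]
  · field_simp
    ring

/-- The permutation matrix of `σ`. -/
def permWeight {V : Type*} [DecidableEq V] (σ : V → V) (u v : V) : ℝ := if σ u = v then 1 else 0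

/-- What remains of `x` after removing `ε` times the permutation matrix of `σ` and rescaling: for
`ε ≠ 1`, `x = (1 - ε) • peel x σ ε + ε • permWeight σ`. -/
noncomputable def peel {V : Type*} [DecidableEq V] (x : V → V → ℝ) (σ : V → V) (ε : ℝ) (u v : V) :
    ℝ := (x u v - ε * permWeight σ u v) / (1 - ε)

lemma permWeight_symm {V : Type*} [DecidableEq V] {σ : V → V} (hσ : IsMatchingMap σ) (u v : V) :
    permWeight σ u v = permWeight σ v u := by
  simp only [permWeight, hσ.eq_comm_iff u v]

lemma cutWeight_permWeight_le (σ : V → V) (T : Finset V) : cutWeight (permWeight σ) T ≤ #T := by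
  unfold cutWeight permWeight
  rw [card_eq_sum_ones, Nat.cast_sum]
  refine sum_le_sum fun u _ => ?_
  rw [sum_ite_eq]
  split_ifs <;> simp

lemma cutWeight_peel (x : V → V → ℝ) (σ : V → V) {ε : ℝ} (T : Finset V) :
    cutWeight (peel x σ ε) T
      = (cutWeight x T - ε * cutWeight (permWeight σ) T) / (1 - ε) := by
  unfold cutWeight peel
  simp only [← sum_div, sum_sub_distrib, ← mul_sum]

lemma isFeasible_peel {x : V → V → ℝ} (hx : IsFeasible x) {σ : V → V} (hσ : IsMatchingMap σ)
    {ε : ℝ} (h1 : ε < 1) (hle : ∀ v, ε ≤ x v (σ v))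
    (hcut : ∀ T : Finset V, Odd #T →
      0 ≤ (cutWeight x T - 1) - ε * (cutWeight (permWeight σ) T - 1)) :
    IsFeasible (peel x σ ε) where
  nonneg u v := by
    refine div_nonneg ?_ (by linarith)
    unfold permWeight
    split_ifs with h
    · have := hle u
      rw [h] at this
      linarith
    · simpa using hx.nonneg u v
  symm u v := by simp only [peel, hx.symm u v, permWeight_symm hσ u v]
  diag u := by simp [peel, permWeight, hx.diag, hσ.ne u]
  deg u := by
    simp only [peel, ← sum_div, sum_sub_distrib, ← mul_sum, hx.deg, permWeight]
    rw [sum_ite_eq, if_pos (mem_univ _), mul_one]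
    exact div_self (sub_ne_zero.2 h1.ne')
  cut T hT := by
    rw [cutWeight_peel, le_div_iff₀ (by linarith)]
    linarith [hcut T hT]

lemma IsMixture.of_peel {x : V → V → ℝ} {σ : V → V} (hσ : IsMatchingMap σ) {ε : ℝ} (h0 : 0 ≤ ε)
    (h1 : ε < 1) (h : IsMixture (peel x σ ε)) : IsMixture x := by
  obtain ⟨ι, _, w, τ, hw, hτ, m⟩ := h
  refine ⟨Option ι, inferInstance, fun o => o.elim ε fun i => (1 - ε) * w i,
    fun o => o.elim σ τ, ?_, ?_, fun u v => ?_⟩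
  · rintro (_ | i)
    · exact h0
    · exact mul_nonneg (by linarith) (hw i)
  · rintro (_ | i)
    exacts [hσ, hτ i]
  · rw [Fintype.sum_option]
    have h := m u v
    have hne : 1 - ε ≠ 0 := by linarith
    simp only [peel, permWeight] at h
    rw [eq_div_iff hne, sum_mul] at h
    have e : ∀ i, (if (some i).elim σ τ u = v then (some i).elim ε fun i => (1 - ε) * w i else 0)
        = (if τ i u = v then w i else 0) * (1 - ε) := fun i => by
      simp only [Option.elim_some, ite_mul, zero_mul, mul_comm]
    simp only [e]
    rw [h]
    change (if σ u = v then ε else 0) + _ = _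
    by_cases hc : σ u = v
    · rw [if_pos hc, if_pos hc]; ring
    · rw [if_neg hc, if_neg hc]; ring

/-- The inductive step on the support: subtracting as much as possible of a perfect matching either
kills an edge or makes a nontrivial odd cut tight. -/
lemma IsFeasible.isMixture_of_tight
    (ih : ∀ y : V → V → ℝ, IsFeasible y → ∀ T : Finset V, Odd #T → 1 < #T → 1 < #Tᶜ →
      cutWeight y T = 1 → IsMixture y) {x : V → V → ℝ} (hx : IsFeasible x) : IsMixture x := by
  induction hn : #{p : V × V | x p.1 p.2 ≠ 0} using Nat.strong_induction_on generalizing x with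
  | _ n IH =>
  subst hn
  rcases isEmpty_or_nonempty V with hV | hV
  · exact ⟨Empty, inferInstance, Empty.elim, Empty.elim, fun i => i.elim, fun i => i.elim,
      fun u => hV.elim u⟩
  obtain ⟨σ, hσ, hpos⟩ := hx.exists_matchingMap
  obtain ⟨u₀, -, hmin⟩ := exists_min_image univ (fun v => x v (σ v)) univ_nonempty
  have hmin : ∀ v, x u₀ (σ u₀) ≤ x v (σ v) := fun v => hmin v (mem_univ v)
  set δ := x u₀ (σ u₀) with hδ
  have hδ0 : 0 < δ := hpos u₀
  rcases lt_or_ge δ 1 with hδ1 | hδ1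
  · by_cases hall : ∀ T ∈ ({T | Odd #T} : Finset (Finset V)),
        0 ≤ (cutWeight x T - 1) - δ * (cutWeight (permWeight σ) T - 1)
    · refine IsMixture.of_peel hσ hδ0.le hδ1 (IH _ ?_ (isFeasible_peel hx hσ hδ1 hmin fun T hT =>
        hall T (by simpa using hT)) rfl)
      have hsub : ∀ p : V × V, peel x σ δ p.1 p.2 ≠ 0 → x p.1 p.2 ≠ 0 := by
        rintro ⟨u, v⟩ hp h0
        have : σ u ≠ v := by
          rintro rfl
          exact (hpos u).ne' h0
        simp [peel, permWeight, this, h0] at hp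
      refine card_lt_card ⟨fun p hp => ?_, fun hss => ?_⟩
      · simp only [mem_filter, mem_univ, true_and] at hp ⊢
        exact hsub p hp
      · have := @hss (u₀, σ u₀) (by simpa using (hpos u₀).ne')
        simp [peel, permWeight, ← hδ] at this
    · push Not at hall
      obtain ⟨ε, hε0, hεδ, hge, T, hT, hb, hz⟩ := exists_first_zero
        ({T | Odd #T} : Finset (Finset V)) (fun T => cutWeight x T - 1)
        (fun T => cutWeight (permWeight σ) T - 1)
        (fun T hT => sub_nonneg.2 (hx.cut T (by simpa using hT))) hδ0.le hall
      have hε1 : ε < 1 := hεδ.trans hδ1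
      have hTodd : Odd #T := by simpa using hT
      have hb' : 1 < cutWeight (permWeight σ) T := by linarith
      -- a tight cut met more than once by the matching has at least two vertices on each side
      have hT1 : 1 < #T := by
        exact_mod_cast hb'.trans_le (cutWeight_permWeight_le σ T)
      have hT2 : 1 < #Tᶜ := by
        rw [← cutWeight_compl (permWeight_symm hσ)] at hb'
        exact_mod_cast hb'.trans_le (cutWeight_permWeight_le σ Tᶜ)
      refine IsMixture.of_peel hσ hε0 hε1 (ih _ (isFeasible_peel hx hσ hε1
        (fun v => hεδ.le.trans (hmin v)) fun S hS => hge S (by simpa using hS)) T hTodd hT1 hT2 ?_)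
      rw [cutWeight_peel, div_eq_one_iff_eq (by linarith)]
      linarith
  · -- every edge of the matching has full weight, so `x` is its permutation matrix
    have hone : ∀ u v, x u v = permWeight σ u v := by
      intro u v
      have hsum : x u (σ u) + ∑ w ∈ {σ u}ᶜ, x u w = 1 := by
        rw [← hx.deg u, ← sum_add_sum_compl {σ u} (x u), sum_singleton]
      have hnn : ∀ w ∈ ({σ u} : Finset V)ᶜ, 0 ≤ x u w := fun w _ => hx.nonneg u w
      have h1 := hδ1.trans (hmin u)
      have h2 := sum_nonneg hnn
      unfold permWeight
      split_ifs with h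
      · subst h
        linarith
      · exact (sum_eq_zero_iff_of_nonneg hnn).1 (by linarith) v (by simpa using Ne.symm h)
    exact ⟨Unit, inferInstance, fun _ => 1, fun _ => σ, fun _ => zero_le_one, fun _ => hσ,
      fun u v => by simp [hone, permWeight]⟩

/-! ### Edmonds' theorem -/

/-- **Edmonds' perfect matching polytope theorem** for the complete graph on `V`. -/
theorem IsFeasible.isMixture {V : Type*} [Fintype V] [DecidableEq V] {x : V → V → ℝ}
    (hx : IsFeasible x) : IsMixture x := by
  induction hn : Fintype.card V using Nat.strong_induction_on generalizing V with
  | _ n IH =>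
  subst hn
  refine hx.isMixture_of_tight fun y hy T hT h1 h2 htight => ?_
  have hc := card_add_card_compl T
  have hTc := hy.odd_compl hT
  refine IsMixture.glue hy T (IH _ ?_ (hy.contract hT htight) rfl)
    (IH _ ?_ (hy.contract hTc (by rw [cutWeight_compl hy.symm, htight])) rfl)
  · rw [Fintype.card_option, Fintype.card_coe]
    omega
  · rw [Fintype.card_option, Fintype.card_coe]
    omega

/-! ### Perfect matchings of a graph -/

lemma mem_covers {α : Type*} [DecidableEq α] {H : Finset (Finset α)} {K : Finset α} :
    K ∈ Looms.covers H ↔ K ⊆ Looms.verts H ∧ ∀ e ∈ H, (K ∩ e).Nonempty := by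
  rw [Looms.covers, mem_filter, mem_powerset]

/-- The set of edges of the perfect matching encoded by `σ`. -/
def matchingEdges (σ : V → V) : Finset (Sym2 V) := univ.image fun v => s(v, σ v)

lemma IsMatchingMap.mk_mem_matchingEdges {σ : V → V} (hσ : IsMatchingMap σ) (a b : V) :
    s(a, b) ∈ matchingEdges σ ↔ σ a = b := by
  simp only [matchingEdges, mem_image, mem_univ, true_and, Sym2.eq_iff]
  constructor
  · rintro ⟨v, ⟨rfl, rfl⟩ | ⟨rfl, rfl⟩⟩
    · rfl
    · exact hσ.invol v
  · rintro rfl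
    exact ⟨a, Or.inl ⟨rfl, rfl⟩⟩

lemma mem_PM {G : SimpleGraph V} {F : Finset (Sym2 V)} :
    F ∈ Looms.PM G ↔ ∃ σ : V → V, IsMatchingMap σ ∧ (∀ v, G.Adj v (σ v)) ∧ F = matchingEdges σ := by
  classical
  simp only [Looms.PM, mem_filter, mem_powerset]
  constructor
  · rintro ⟨-, M, hM, hF⟩
    rw [SimpleGraph.Subgraph.isPerfectMatching_iff] at hM
    choose σ hσ hu using hM
    have hm : IsMatchingMap σ :=
      ⟨fun v => (hu _ v (M.adj_symm (hσ v))).symm, fun v => (M.adj_sub (hσ v)).ne'⟩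
    refine ⟨σ, hm, fun v => M.adj_sub (hσ v), ?_⟩
    ext e
    induction e with | _ a b
    rw [← mem_coe, ← hF, SimpleGraph.Subgraph.mem_edgeSet, hm.mk_mem_matchingEdges]
    exact ⟨fun h => (hu a b h).symm, fun h => h ▸ hσ a⟩
  · rintro ⟨σ, hσ, hadj, rfl⟩
    refine ⟨fun e he => ?_, ⟨Set.univ, fun a b => σ a = b, ?_, ?_, ?_⟩, ?_, ?_⟩
    · obtain ⟨v, -, rfl⟩ := mem_image.1 he
      simpa using hadj v
    · rintro a b rfl
      exact hadj a
    · exact fun _ => Set.mem_univ _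
    · exact ⟨fun a b h => (hσ.eq_comm_iff a b).1 h⟩
    · rw [SimpleGraph.Subgraph.isPerfectMatching_iff]
      exact fun v => ⟨σ v, rfl, fun w (h : σ v = w) => h.symm⟩
    · ext e
      induction e with | _ a b
      rw [SimpleGraph.Subgraph.mem_edgeSet, mem_coe, hσ.mk_mem_matchingEdges]

lemma mem_edgeSet_of_mem_verts_PM {G : SimpleGraph V} {e : Sym2 V}
    (he : e ∈ Looms.verts (Looms.PM G)) : e ∈ G.edgeSet := by
  obtain ⟨F, hF, heF⟩ := mem_biUnion.1 he
  obtain ⟨σ, -, hadj, rfl⟩ := mem_PM.1 hF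
  obtain ⟨v, -, rfl⟩ := mem_image.1 heF
  exact hadj v

/-- Every perfect matching uses exactly one edge at the vertex `v`. -/
lemma sum_PM_eq_sum_neighbors (G : SimpleGraph V) [DecidableRel G.Adj] (v : V)
    (f : Finset (Sym2 V) → ℝ) :
    ∑ F ∈ Looms.PM G, f F
      = ∑ w ∈ G.neighborFinset v, ∑ F ∈ Looms.PM G with s(v, w) ∈ F, f F := by
  simp only [sum_filter]
  rw [sum_comm]
  refine sum_congr rfl fun F hF => ?_
  obtain ⟨σ, hσ, hadj, rfl⟩ := mem_PM.1 hF
  simp only [hσ.mk_mem_matchingEdges]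
  rw [sum_ite_eq, if_pos (by simpa using hadj v)]

/-! ### Parity -/

lemma even_card_of_involution {α : Type*} (T : Finset α) (g : α → α) (h1 : ∀ a ∈ T, g a ∈ T)
    (h2 : ∀ a ∈ T, g (g a) = a) (h3 : ∀ a ∈ T, g a ≠ a) : Even #T := by
  rw [← ZMod.natCast_eq_zero_iff_even, card_eq_sum_ones, Nat.cast_sum]
  exact sum_involution (fun a _ => g a) (fun _ _ => by decide) (fun a ha _ => h3 a ha) h1 h2

/-- The pairs `(u, v)` with `u ∈ T`, `v ∉ T` that are edges of `G`. -/
def cutPairs (G : SimpleGraph V) [DecidableRel G.Adj] (T : Finset V) : Finset (V × V) :=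
  {p ∈ T ×ˢ Tᶜ | G.Adj p.1 p.2}

lemma exists_crossing_edge {σ : V → V} (hσ : IsMatchingMap σ) {T : Finset V} (hT : Odd #T) :
    ∃ u ∈ T, σ u ∉ T := by
  by_contra! h
  exact Nat.not_even_iff_odd.2 hT
    (even_card_of_involution T σ h (fun a _ => hσ.invol a) fun a _ => hσ.ne a)

variable (G : SimpleGraph V) [DecidableRel G.Adj] {s : ℕ}

lemma odd_card_cutPairs_iff (hG : G.IsRegularOfDegree s) {T : Finset V} (hT : Odd #T) :
    Odd #(cutPairs G T) ↔ Odd s := by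
  have hin : Even #{p ∈ T ×ˢ T | G.Adj p.1 p.2} := by
    refine even_card_of_involution _ Prod.swap ?_ ?_ ?_
    · rintro ⟨a, b⟩ h
      simp only [mem_filter, mem_product, Prod.swap] at h ⊢
      exact ⟨h.1.symm, h.2.symm⟩
    · exact fun a _ => a.swap_swap
    · rintro ⟨a, b⟩ h he
      simp only [mem_filter, Prod.swap, Prod.mk.injEq] at h he
      exact h.2.ne he.2
  have hall : #{p ∈ T ×ˢ T | G.Adj p.1 p.2} + #(cutPairs G T) = #T * s := by
    rw [cutPairs, card_filter, card_filter, sum_product, sum_product, ← sum_add_distrib,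
      ← smul_eq_mul, ← sum_const]
    refine sum_congr rfl fun u _ => ?_
    rw [sum_add_sum_compl T fun v => if G.Adj u v then 1 else 0, ← card_filter, ← hG u,
      ← SimpleGraph.card_neighborFinset_eq_degree, SimpleGraph.neighborFinset_eq_filter]
  have h : Odd (#T * s) ↔ Odd s := by simp [Nat.odd_mul, hT]
  rw [← h, ← hall, Nat.odd_add', iff_true_right hin]

/-- The edges of an odd cut cover `PM(G)`. -/
lemma coveringNumber_PM_le {T : Finset V} (hT : Odd #T) :
    Looms.coveringNumber (Looms.PM G) ≤ #(cutPairs G T) := by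
  let K := {e ∈ (cutPairs G T).image fun p => s(p.1, p.2) | e ∈ Looms.verts (Looms.PM G)}
  have hK : K ∈ Looms.covers (Looms.PM G) := by
    refine mem_covers.2 ⟨fun e he => (mem_filter.1 he).2, fun F hF => ?_⟩
    obtain ⟨σ, hσ, hadj, rfl⟩ := mem_PM.1 hF
    obtain ⟨u, huT, hu⟩ := exists_crossing_edge hσ hT
    have hmem : s(u, σ u) ∈ matchingEdges σ := (hσ.mk_mem_matchingEdges _ _).2 rfl
    refine ⟨s(u, σ u), mem_inter.2 ⟨mem_filter.2 ⟨mem_image.2 ⟨(u, σ u), ?_, rfl⟩, ?_⟩, hmem⟩⟩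
    · simpa [cutPairs, huT, hu] using hadj u
    · exact mem_biUnion.2 ⟨_, hF, hmem⟩
  refine (iInf₂_le K hK).trans ?_
  exact_mod_cast (card_filter_le _ _).trans card_image_le

/-- Parity makes a covering number of at least `s - 1` enough to force every odd cut to have at
least `s` edges. -/
lemma le_card_cutPairs (hG : G.IsRegularOfDegree s)
    (hτ : (s : ℕ∞) ≤ Looms.coveringNumber (Looms.PM G) + 1) {T : Finset V} (hT : Odd #T) :
    s ≤ #(cutPairs G T) := by
  have h1 : s ≤ #(cutPairs G T) + 1 := by
    exact_mod_cast hτ.trans (add_le_add_left (coveringNumber_PM_le G hT) 1)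
  have h2 := odd_card_cutPairs_iff G hG hT
  rw [Nat.odd_iff, Nat.odd_iff] at h2
  omega

/-! ### The uniform weighting of a regular graph -/

lemma isFeasible_uniform (hs : s ≠ 0) (hG : G.IsRegularOfDegree s)
    (hcut : ∀ T : Finset V, Odd #T → s ≤ #(cutPairs G T)) :
    IsFeasible fun u v => if G.Adj u v then (s : ℝ)⁻¹ else 0 where
  nonneg u v := by positivity
  symm u v := by simp only [G.adj_comm]
  diag u := by simp
  deg u := by
    rw [← sum_filter, sum_const, ← SimpleGraph.neighborFinset_eq_filter,
      SimpleGraph.card_neighborFinset_eq_degree, hG u, nsmul_eq_mul, mul_inv_cancel₀]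
    exact_mod_cast hs
  cut T hT := by
    have hs' : (0 : ℝ) < s := by positivity
    rw [cutWeight, ← sum_product', ← sum_filter, sum_const, nsmul_eq_mul, ← div_eq_mul_inv,
      le_div_iff₀ hs', one_mul]
    exact_mod_cast hcut T hT

/-- Scaling the decomposition of the uniform weighting by `s` gives a fractional
`s`-edge-colouring: weights on the perfect matchings that sum to `1` at each edge. -/
lemma exists_fractional_edge_colouring (hs : s ≠ 0) (hG : G.IsRegularOfDegree s)
    (hτ : (s : ℕ∞) ≤ Looms.coveringNumber (Looms.PM G) + 1) :
    ∃ f : Finset (Sym2 V) → ℝ, (∀ F, 0 ≤ f F) ∧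
      ∀ e ∈ G.edgeSet, ∑ F ∈ Looms.PM G with e ∈ F, f F = 1 := by
  obtain ⟨ι, _, w, σ, hw, hσ, m⟩ := (isFeasible_uniform G hs hG
    fun T hT => le_card_cutPairs G hG hτ hT).isMixture
  have hzero : ∀ i, matchingEdges (σ i) ∉ Looms.PM G → w i = 0 := by
    intro i hi
    obtain ⟨v, hv⟩ : ∃ v, ¬ G.Adj v (σ i v) := by
      by_contra! h
      exact hi (mem_PM.2 ⟨σ i, hσ i, h, rfl⟩)
    have h := m v (σ i v)
    simp only [if_neg hv] at h
    rw [sum_eq_zero_iff_of_nonneg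
      (fun k _ => by split_ifs; exacts [hw k, le_rfl])] at h
    simpa using h i (mem_univ _)
  refine ⟨fun F => s * ∑ i, if matchingEdges (σ i) = F then w i else 0, fun F => ?_, fun e he => ?_⟩
  · exact mul_nonneg (Nat.cast_nonneg _)
      (sum_nonneg fun k _ => by split_ifs; exacts [hw k, le_rfl])
  · induction e with | _ a b
    have hab : G.Adj a b := he
    rw [← mul_sum, sum_comm]
    have : ∀ i, ∑ F ∈ Looms.PM G with s(a, b) ∈ F, (if matchingEdges (σ i) = F then w i else 0)
        = if σ i a = b then w i else 0 := fun i => by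
      rw [sum_ite_eq]
      simp only [mem_filter, (hσ i).mk_mem_matchingEdges]
      by_cases hi : matchingEdges (σ i) ∈ Looms.PM G
      · simp [hi]
      · simp [hzero i hi]
    simp only [this]
    rw [m]
    simp only [if_pos hab]
    rw [mul_inv_cancel₀]
    exact_mod_cast hs

/-- The edges at a vertex form a cover of size `s`, so no fractional matching exceeds `s`. -/
lemma sum_fracMatching_le [Nonempty V] (hG : G.IsRegularOfDegree s) {f : Finset (Sym2 V) → ℝ}
    (hf : Looms.IsFracMatching (Looms.PM G) f) : ∑ F ∈ Looms.PM G, f F ≤ s := by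
  obtain ⟨v⟩ := ‹Nonempty V›
  rw [sum_PM_eq_sum_neighbors G v, ← hG v, ← SimpleGraph.card_neighborFinset_eq_degree,
    card_eq_sum_ones, Nat.cast_sum]
  refine sum_le_sum fun w _ => ?_
  by_cases h : s(v, w) ∈ Looms.verts (Looms.PM G)
  · simpa using hf.2 _ h
  · have hn : ∀ F ∈ Looms.PM G, s(v, w) ∉ F := fun F hF he => h (mem_biUnion.2 ⟨F, hF, he⟩)
    rw [filter_false_of_mem hn]
    simp

lemma isPerfectFracMatching_of_sum_eq_one {f : Finset (Sym2 V) → ℝ} (h0 : ∀ F, 0 ≤ f F)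
    (h1 : ∀ e ∈ G.edgeSet, ∑ F ∈ Looms.PM G with e ∈ F, f F = 1) :
    Looms.IsPerfectFracMatching (Looms.PM G) f :=
  ⟨⟨fun F _ => h0 F, fun e he => (h1 e (mem_edgeSet_of_mem_verts_PM he)).le⟩,
    fun e he => h1 e (mem_edgeSet_of_mem_verts_PM he)⟩

theorem fracMatchingNumberEq_PM [Nonempty V] (hG : G.IsRegularOfDegree s)
    (hτ : (s : ℕ∞) ≤ Looms.coveringNumber (Looms.PM G) + 1) :
    Looms.FracMatchingNumberEq (Looms.PM G) (s : ℝ) := by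
  refine ⟨?_, ?_⟩
  · rcases eq_or_ne s 0 with rfl | hs
    · have h0 : Looms.IsFracMatching (Looms.PM G) fun _ => 0 := ⟨fun _ _ => le_rfl, by simp⟩
      exact ⟨_, h0, by simp⟩
    · obtain ⟨f, h0, h1⟩ := exists_fractional_edge_colouring G hs hG hτ
      refine ⟨f, (isPerfectFracMatching_of_sum_eq_one G h0 h1).1, ?_⟩
      obtain ⟨v⟩ := ‹Nonempty V›
      rw [sum_PM_eq_sum_neighbors G v, sum_congr rfl fun w hw => h1 s(v, w) (by simpa using hw)]
      simp [hG v]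
  · rintro _ ⟨f, hf, rfl⟩
    exact sum_fracMatching_le G hG hf

/-! ### Vertex stars -/

/-- The set of edges of `G` at `v`. -/
def vertexStar (v : V) : Finset (Sym2 V) := (G.neighborFinset v).image fun w => s(v, w)

lemma mk_mem_vertexStar {a b v : V} (hab : G.Adj a b) : s(a, b) ∈ vertexStar G v ↔ v ∈ ({a, b} : Finset V) := by
  simp only [vertexStar, mem_image, SimpleGraph.mem_neighborFinset, Sym2.eq_iff, mem_insert,
    mem_singleton]
  constructor
  · rintro ⟨w, -, ⟨rfl, -⟩ | ⟨rfl, -⟩⟩ <;> simp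
  · rintro (rfl | rfl)
    · exact ⟨b, hab, Or.inl ⟨rfl, rfl⟩⟩
    · exact ⟨a, hab.symm, Or.inr ⟨rfl, rfl⟩⟩

lemma vertexStar_mem_coversOfCard (hG : G.IsRegularOfDegree s)
    (hE : ∀ e ∈ G.edgeSet, e ∈ Looms.verts (Looms.PM G)) (v : V) :
    vertexStar G v ∈ Looms.coversOfCard s (Looms.PM G) := by
  refine mem_filter.2 ⟨mem_covers.2 ⟨fun e he => ?_, fun F hF => ?_⟩, ?_⟩
  · obtain ⟨w, hw, rfl⟩ := mem_image.1 he
    exact hE _ (by simpa using hw)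
  · obtain ⟨σ, hσ, hadj, rfl⟩ := mem_PM.1 hF
    exact ⟨s(v, σ v), mem_inter.2
      ⟨(mk_mem_vertexStar G (hadj v)).2 (by simp), (hσ.mk_mem_matchingEdges _ _).2 rfl⟩⟩
  · rw [vertexStar, card_image_of_injective _ (fun a b h => Sym2.congr_right.1 h),
      SimpleGraph.card_neighborFinset_eq_degree, hG v]

/-- Giving weight `1/2` to each vertex vertexStar, counted with multiplicity, covers each edge with total
weight `1` since it lies in the stars of its two endpoints. -/
lemma hasPerfectFracMatching_coversOfCard (hG : G.IsRegularOfDegree s)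
    (hE : ∀ e ∈ G.edgeSet, e ∈ Looms.verts (Looms.PM G)) :
    Looms.HasPerfectFracMatching (Looms.coversOfCard s (Looms.PM G)) := by
  let g : Finset (Sym2 V) → ℝ := fun b => ∑ v, if vertexStar G v = b then 1 / 2 else 0
  have hsum : ∀ e ∈ Looms.verts (Looms.coversOfCard s (Looms.PM G)),
      ∑ b ∈ Looms.coversOfCard s (Looms.PM G) with e ∈ b, g b = 1 := by
    intro e he
    obtain ⟨K, hK, heK⟩ := mem_biUnion.1 he
    have he' : e ∈ G.edgeSet := mem_edgeSet_of_mem_verts_PM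
      ((mem_covers.1 (mem_filter.1 hK).1).1 heK)
    induction e with | _ a b
    have hab : G.Adj a b := he'
    rw [sum_comm]
    have : ∀ v, ∑ c ∈ Looms.coversOfCard s (Looms.PM G) with s(a, b) ∈ c,
        (if vertexStar G v = c then (1 / 2 : ℝ) else 0) = if v ∈ ({a, b} : Finset V) then 1 / 2 else 0 :=
      fun v => by
        rw [sum_ite_eq]
        simp only [mem_filter, mk_mem_vertexStar G hab, vertexStar_mem_coversOfCard G hG hE v, true_and]
    simp only [this]
    rw [sum_ite_mem, univ_inter, sum_pair hab.ne]
    norm_num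
  exact ⟨g, ⟨fun b _ => sum_nonneg fun v _ => by positivity, fun e he => (hsum e he).le⟩, hsum⟩

end MatchingPolytope

theorem mainTheorem10 {V : Type*} [Fintype V] [DecidableEq V] [Nonempty V]
    (G : SimpleGraph V) [DecidableRel G.Adj] (s : ℕ) (hG : G.IsRegularOfDegree s) :
    ((s : ℕ∞) ≤ Looms.coveringNumber (Looms.PM G) + 1 →
      Looms.FracMatchingNumberEq (Looms.PM G) (s : ℝ)) ∧
    (∀ r : ℕ, Looms.IsLoom r s (Looms.PM G) (Looms.coversOfCard s (Looms.PM G)) →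
      Looms.HasPerfectFracMatching (Looms.PM G) ∧
      Looms.HasPerfectFracMatching (Looms.coversOfCard s (Looms.PM G))) := by
  refine ⟨MatchingPolytope.fracMatchingNumberEq_PM G hG, fun r hL => ?_⟩
  obtain ⟨f, h0, h1⟩ := MatchingPolytope.exists_fractional_edge_colouring G
    (Nat.one_le_iff_ne_zero.1 hL.one_le_right) hG (hL.coveringNumber_left ▸ le_self_add)
  refine ⟨⟨f, MatchingPolytope.isPerfectFracMatching_of_sum_eq_one G h0 h1⟩,
    MatchingPolytope.hasPerfectFracMatching_coversOfCard G hG fun e he => ?_⟩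
  obtain ⟨F, hF, -⟩ := Finset.exists_ne_zero_of_sum_ne_zero ((h1 e he).trans_ne one_ne_zero)
  rw [Finset.mem_filter] at hF
  exact Finset.mem_biUnion.2 ⟨F, hF⟩
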